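/- **Setting.** Let $N\ge 2$, $\alpha\ge 0$ and $r=(r_1,r_2)\in[0,1]^2$; write $(a)^+=\max(a,0)$. In the two-user fading interference channel at signal-to-noise ratio $\rho$, receiver $i$ observes $y_i=\sqrt{\rho}\,h_{ii}x_i+\sqrt{\rho^{\alpha}}\,h_{ji}x_j+z_i\in\mathbb C^N$ ($j\ne i$), with independent $h_{ii},h_{ji}\sim\mathcal{CN}(0,1)$ (known to receiver $i$ only) and $z_i\sim\mathcal{CN}(0,I_N)$. User $i$ sends $x_i=u_i+w_i$, with private $u_i\in\mathcal C^{u_i}(\rho)$ and public $w_i\in\mathcal C^{w_i}(\rho)$ uniform on finite codebooks in $\mathbb C^N$ and all messages independent. Receiver $i$ decodes $(u_i,w_i,w_j)$ jointly by maximum likelihood, $u_j$ being treated as noise (uniform on its codebook). $P(E_{ii})$ is the probability, over messages, fading and noise, that $(u_i,w_i)$ is decoded incorrectly (ties count as errors), and $P(E)=\max\{P(E_{11}),P(E_{22})\}$. A codebook sequence has multiplexing rate $a$ if its codebooks are non-empty and $\log|\mathcal C(\rho)|/\log\rho\to Na$ as $\rho\to\infty$. Write $f\,\dot\le\,\rho^{c}$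 if for every $\delta>0$, $f(\rho)\le\rho^{c+\delta}$ for all large $\rho$, and define $\dot\ge$ analogously; for codeword differences $\dot\ge$ is meant uniformly over all the pairs considered. **Exponents.** Let $d_{MU}^i(r)=(1-r_i)^+$ for $i=1,2$, $d_{MU}^3(r)=(1-r_1-r_2)^++(\alpha-r_1-r_2)^+$, and $d_{MU}=\min_{i=1,2,3} d_{MU}^i$. For $s,p\in\mathbb R^2$ and $i\neq j$ put $\nu_j=(\alpha-1+p_j)^+$ and $$d_{i1}=(p_i-s_i-\nu_j)^+,\quad d_{i2}=(1-r_i+s_i-\nu_j)^+,\quad d_{i3}=(1-r_i-\nu_j)^+,$$ and, for $m=4,5,6$, $$d_{im}=\begin{cases}(c_m-q_m)^++(\alpha-q_m)^+,& p_j<1-q_m,\\ (c_m-q_m-\nu_j)^+,& p_j\ge 1-q_m,\end{cases}$$ where $c_4=p_i$, $c_5=c_6=1$, $q_4=s_i+r_j-s_j$, $q_5=r_1+r_2-s_1-s_2$, $q_6=r_i+r_j-s_j$. Let $d(r,s,p)=\min_{k=1,2;\,l=1,\dots,6}d_{kl}(r,s,p)$. Call $(s,t,p)$ admissible if $s_i+t_i=r_i$,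 $s_i,t_i\ge0$, $0\le p_i<1$ for $i=1,2$; let $d_{HK}(r)=\sup d(r,s,p)$ over admissible $(s,t,p)$, and $d(r)=\max\{d_{HK}(r),d_{MU}(r)\}$. For vectors $a,b\in\mathbb C^N$ let $\lambda(a,b)$ be the smallest eigenvalue of the Gram matrix $[a\ b]^H[a\ b]$. Every $\epsilon\ge0$ below may be different, but does not depend on $\rho$. **Theorem.** (1) Suppose $d_{HK}(r)\le d_{MU}(r)$. Let $j^*\in\arg\min_i d_{MU}^i(r)$ and let $\Gamma_i=(\gamma_i^1,\gamma_i^2)\in\mathbb R^2$, $i=1,2,3$, satisfy $d_{MU}^i(\Gamma_i)=d_{MU}^{j^*}(r)$. Let only public messages be used ($u_i=0$, $x_i=w_i$), with codebook sequences $\mathcal C^{x_i}$ of multiplexing rates $r_i$ and $\|x_i\|^2\le N$ for all codewords and all $\rho>1$. If for some $\epsilon\ge0$ $$\|\Delta x_i\|^2\ \dot\ge\ \rho^{-\gamma_i^i+\epsilon}\ (i=1,2),\qquad \lambda(\Delta x_1,\Delta x_2)\ \dot\ge\ \rho^{-\gamma_3^1-\gamma_3^2+\epsilon}$$ for all differences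 $\Delta x_i$ of distinct codewords of $\mathcal C^{x_i}(\rho)$, then the DMT $d(r)$ is achieved: $P(E)\,\dot\le\,\rho^{-d(r)}$. (2) Suppose $d_{HK}(r)>d_{MU}(r)$. Let $(s,t,p)$ be admissible, let $(k^*,l^*)$ minimize $d_{kl}(r,s,p)$, and let $\Upsilon_{nm},\Psi_{nm}\in\mathbb R^2$ (components $\upsilon_{nm}^k,\psi_{nm}^k$) satisfy $d_{nm}(\Upsilon_{nm},\Psi_{nm},p)\ge d_{k^*l^*}(r,s,p)$ for $n=1,2$, $m=1,\dots,6$ (in particular, equality is allowed). Let $\mathcal C^{u_i},\mathcal C^{w_i}$ be codebook sequences of multiplexing rates $s_i,t_i$ with $\|u_i\|\le\sqrt{N/\rho^{1-p_i}}$ and $\|w_i\|\le\sqrt N\,(1-\sqrt{1/\rho^{1-p_i}})$ for all codewords and all $\rho>1$. Let $\Delta u_i=\sqrt{\rho^{1-p_i}}(\tilde u_i-\hat u_i)$ and $\Delta w_i=\tilde w_i-\hat w_i$ run over pairs of distinct codewords, and $\Delta x_i=(\tilde u_i+\tilde w_i)-(\hat u_i+\hat w_i)$ over pairs with $\tilde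 u_i\ne\hat u_i$ and $\tilde w_i\neq\hat w_i$. If for some $\epsilon\ge0$ and for all $i,j\in\{1,2\}$, $i\ne j$, $$\begin{aligned} \|\Delta u_i\|^2&\ \dot\ge\ \rho^{-\psi_{i1}^i+\epsilon}, & \lambda(\Delta u_i,\Delta w_j)&\ \dot\ge\ \rho^{-\psi_{i4}^i-\upsilon_{i4}^j+\psi_{i4}^j+\epsilon},\\ \|\Delta w_i\|^2&\ \dot\ge\ \rho^{-\upsilon_{i2}^i+\psi_{i2}^i+\epsilon}, & \lambda(\Delta w_i,\Delta w_j)&\ \dot\ge\ \rho^{-\upsilon_{i5}^1-\upsilon_{i5}^2+\psi_{i5}^1+\psi_{i5}^2+\epsilon},\\ \|\Delta x_i\|^2&\ \dot\ge\ \rho^{-\upsilon_{i3}^i+\epsilon}, & \lambda(\Delta x_i,\Delta w_j)&\ \dot\ge\ \rho^{-\upsilon_{i6}^i-\upsilon_{i6}^j+\psi_{i6}^j+\epsilon}, \end{aligned}$$ then $P(E)\,\dot\le\,\rho^{-d(r,s,p)}$. In particular, if $(s,t,p)=(s^*,t^*,p^*)$ attains the supremum $d_{HK}(r)$, then the DMT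 $d(r)$ is achieved: $P(E)\,\dot\le\,\rho^{-d(r)}$. -/

import Mathlib

open MeasureTheory Filter Topology

noncomputable section

namespace FadingIC

/-! ### SNR exponents -/

/-- `f ≤̇ ρ ^ c`: for every `δ > 0`, `f ρ ≤ ρ ^ (c + δ)` for all large `ρ`.
(This form also makes sense where `f` vanishes.) -/
def ExpLE (f : ℝ → ℝ) (c : ℝ) : Prop :=
  ∀ δ : ℝ, 0 < δ → ∀ᶠ ρ in atTop, f ρ ≤ ρ ^ (c + δ)

/-- `v ≥̇ ρ ^ c` for the values `v ∈ S ρ`, uniformly over the set `S ρ`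
(equivalently, for the smallest element when `S ρ` is finite and non-empty). -/
def ExpGE (S : ℝ → Set ℝ) (c : ℝ) : Prop :=
  ∀ δ : ℝ, 0 < δ → ∀ᶠ ρ in atTop, ∀ v ∈ S ρ, ρ ^ (c - δ) ≤ v

/-! ### The exponents of the multiuser (public messages only) scheme -/

/-- The three exponents of the scheme that uses public messages only. -/
def dMUi (α : ℝ) (i : Fin 3) (r : Fin 2 → ℝ) : ℝ :=
  ![max (1 - r 0) 0,
    max (1 - r 1) 0,
    max (1 - r 0 - r 1) 0 + max (α - r 0 - r 1) 0] i

def dMU (α : ℝ) (r : Fin 2 → ℝ) : ℝ := ⨅ i : Fin 3, dMUi α i r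

/-! ### The exponents of the superposition scheme

Below, `i` is the receiver, `j = other i`, `r` the multiplexing rates, `s` the private rates,
`p` the power exponents of the private messages. -/

/-- The other user. -/
def other (i : Fin 2) : Fin 2 := Fin.rev i

def d1 (α : ℝ) (i : Fin 2) (_r s p : Fin 2 → ℝ) : ℝ :=
  if p (other i) < 1 - α then max (p i - s i) 0
  else max (1 - α - p (other i) + p i - s i) 0

def d2 (α : ℝ) (i : Fin 2) (r s p : Fin 2 → ℝ) : ℝ :=
  if p (other i) < 1 - α then max (1 - r i + s i) 0
  else max (2 - α - p (other i) - r i + s i) 0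

def d3 (α : ℝ) (i : Fin 2) (r _s p : Fin 2 → ℝ) : ℝ :=
  if p (other i) < 1 - α then max (1 - r i) 0
  else max (2 - α - p (other i) - r i) 0

def d4 (α : ℝ) (i : Fin 2) (r s p : Fin 2 → ℝ) : ℝ :=
  if p (other i) < 1 - s i - r (other i) + s (other i) then
    max (p i - s i - r (other i) + s (other i)) 0 + max (α - s i - r (other i) + s (other i)) 0
  else if p (other i) < 1 - α then
    max (p i - s i - r (other i) + s (other i)) 0
  else
    max (1 - α - p (other i) + p i - s i - r (other i) + s (other i)) 0

def d5 (α : ℝ) (i : Fin 2) (r s p : Fin 2 → ℝ) : ℝ :=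
  if p (other i) < 1 - (∑ k, r k) + ∑ l, s l then
    max (1 - (∑ k, r k) + ∑ l, s l) 0 + max (α - (∑ k, r k) + ∑ l, s l) 0
  else if p (other i) < 1 - α then
    max (1 - (∑ k, r k) + ∑ l, s l) 0
  else
    max (2 - α - p (other i) - (∑ k, r k) + ∑ l, s l) 0

def d6 (α : ℝ) (i : Fin 2) (r s p : Fin 2 → ℝ) : ℝ :=
  if p (other i) < 1 - r i - r (other i) + s (other i) then
    max (1 - r i - r (other i) + s (other i)) 0 + max (α - r i - r (other i) + s (other i)) 0
  else if p (other i) < 1 - α then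
    max (1 - r i - r (other i) + s (other i)) 0
  else
    max (2 - α - p (other i) - r i - r (other i) + s (other i)) 0

/-- The twelve exponents `d_{kl}`; `l : Fin 6` stands for `l = 1, …, 6`. -/
def dkl (α : ℝ) (k : Fin 2) (l : Fin 6) (r s p : Fin 2 → ℝ) : ℝ :=
  ![d1 α k r s p, d2 α k r s p, d3 α k r s p, d4 α k r s p, d5 α k r s p, d6 α k r s p] l

/-- `d(r, s, p)`, the smallest of the `d_{kl}(r, s, p)`. -/
def dSplit (α : ℝ) (r s p : Fin 2 → ℝ) : ℝ := ⨅ kl : Fin 2 × Fin 6, dkl α kl.1 kl.2 r s p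

/-- Admissible private rates `s`, public rates `t` and power exponents `p`. -/
def Feasible (r s t p : Fin 2 → ℝ) : Prop :=
  ∀ i, s i + t i = r i ∧ 0 ≤ s i ∧ 0 ≤ t i ∧ 0 ≤ p i ∧ p i < 1

/-- `d_HK(r)`, the optimum of `d(r, s, p)` over all admissible `s`, `t`, `p`. -/
def dHK (α : ℝ) (r : Fin 2 → ℝ) : ℝ :=
  sSup {d | ∃ s t p, Feasible r s t p ∧ d = dSplit α r s p}

/-- `(s, t, p)` solves the optimization problem that defines `d_HK(r)`. -/
def IsOptimalSplit (α : ℝ) (r s t p : Fin 2 → ℝ) : Prop :=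
  Feasible r s t p ∧ ∀ s' t' p', Feasible r s' t' p' → dSplit α r s' p' ≤ dSplit α r s p

/-- The DMT of the fixed-power-split scheme. -/
def dmt (α : ℝ) (r : Fin 2 → ℝ) : ℝ := max (dHK α r) (dMU α r)

/-! ### The channel and joint maximum-likelihood decoding -/

/-- Vectors in `ℂ^N` with the Euclidean norm. -/
abbrev V (N : ℕ) : Type := EuclideanSpace ℂ (Fin N)

/-- The law `CN(0, 1)`, with density `π⁻¹ exp (-|z|²)` on `ℂ`. -/
def cn : Measure ℂ :=
  volume.withDensity fun z => ENNReal.ofReal (Real.pi⁻¹ * Real.exp (-‖z‖ ^ 2))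

/-- The law `CN(0, I_N)` on `ℂ^N`: independent `CN(0, 1)` coordinates. -/
def cnVec (N : ℕ) : Measure (V N) :=
  (Measure.pi fun _ : Fin N => cn).map (WithLp.toLp 2)

/-- The noiseless received signal `√ρ h_{ii} x_i + √(ρ^α) h_{ji} x_j`; here `h.1 = h_{ii}` and
`h.2 = h_{ji}`. -/
def signal {N : ℕ} (α ρ : ℝ) (h : ℂ × ℂ) (x x' : V N) : V N :=
  ((√ρ : ℂ) * h.1) • x + ((√(ρ ^ α) : ℂ) * h.2) • x'

/-- The likelihood (up to a constant factor) of the triple of own private message `u`, own public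
message `w` and interfering public message `v`, given the received vector `y` and the channel `h`.
The interfering private message, which is not decoded, is uniform on its codebook `Cuj`. -/
def likelihood {N : ℕ} (α ρ : ℝ) (Cuj : Finset (V N)) (h : ℂ × ℂ) (y u w v : V N) : ℝ :=
  ∑ u' ∈ Cuj, Real.exp (-‖y - signal α ρ h (u + w) (u' + v)‖ ^ 2)

/-- The joint maximum-likelihood decoder at receiver `i` fails to recover the own message
`(u, w)` from `y`: a triple with a wrong own message has a likelihood at least as large as every
triple with the correct own message. Ties count as errors; a wrong decision on the interfering
message alone is not an error. -/
def DecodingError {N : ℕ} (α ρ : ℝ) (Cu Cw : Fin 2 → Finset (V N)) (i : Fin 2)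
    (h : ℂ × ℂ) (y u w : V N) : Prop :=
  ∃ u₁ ∈ Cu i, ∃ w₁ ∈ Cw i, ∃ v₁ ∈ Cw (other i), (u₁, w₁) ≠ (u, w) ∧
    ∀ v ∈ Cw (other i),
      likelihood α ρ (Cu (other i)) h y u w v ≤ likelihood α ρ (Cu (other i)) h y u₁ w₁ v₁

/-- `P(E_ii)`: the error probability at receiver `i`, averaged over equally likely messages of
both users, over the independent `CN(0, 1)` fading coefficients and over the noise. -/
def rxErrorProb {N : ℕ} (α ρ : ℝ) (Cu Cw : Fin 2 → Finset (V N)) (i : Fin 2) : ℝ :=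
  (((Cu i).card : ℝ) * (Cw i).card * (Cu (other i)).card * (Cw (other i)).card)⁻¹ *
    ∑ u ∈ Cu i, ∑ w ∈ Cw i, ∑ u' ∈ Cu (other i), ∑ v ∈ Cw (other i),
      ((cn.prod cn).prod (cnVec N)).real
        {ω | DecodingError α ρ Cu Cw i ω.1 (signal α ρ ω.1 (u + w) (u' + v) + ω.2) u w}

/-- `P(E) = max {P(E_11), P(E_22)}`. -/
def errorProb {N : ℕ} (α ρ : ℝ) (Cu Cw : Fin 2 → Finset (V N)) : ℝ :=
  max (rxErrorProb α ρ Cu Cw 0) (rxErrorProb α ρ Cu Cw 1)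

/-! ### Codebook sequences and their differences -/

/-- A sequence (in the SNR `ρ`) of codebooks in `ℂ^N` of multiplexing rate `r`:
`|C ρ| ≐ ρ ^ (N r)`. -/
structure IsCodebookSeq {N : ℕ} (r : ℝ) (C : ℝ → Finset (V N)) : Prop where
  nonempty : ∀ ρ, (C ρ).Nonempty
  rate : Tendsto (fun ρ => Real.log (C ρ).card / Real.log ρ) atTop (𝓝 (N * r))

/-- Differences of distinct codewords. -/
def diffs {N : ℕ} (C : ℝ → Finset (V N)) (ρ : ℝ) : Set (V N) :=
  {d | ∃ a ∈ C ρ, ∃ b ∈ C ρ, a ≠ b ∧ d = a - b}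

/-- Differences of distinct private codewords, rescaled by `√(ρ^(1-p))`. -/
def privateDiffs {N : ℕ} (p : ℝ) (C : ℝ → Finset (V N)) (ρ : ℝ) : Set (V N) :=
  {d | ∃ a ∈ C ρ, ∃ b ∈ C ρ, a ≠ b ∧ d = (√(ρ ^ (1 - p)) : ℂ) • (a - b)}

/-- Differences of superposition codewords `u + w` whose private and public parts both differ. -/
def combinedDiffs {N : ℕ} (Cu Cw : ℝ → Finset (V N)) (ρ : ℝ) : Set (V N) :=
  {d | ∃ a ∈ Cu ρ, ∃ b ∈ Cu ρ, ∃ a' ∈ Cw ρ, ∃ b' ∈ Cw ρ,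
    a ≠ b ∧ a' ≠ b' ∧ d = (a + a') - (b + b')}

/-- The `N × 2` matrix with columns `a` and `b`. -/
def stack {N : ℕ} (a b : V N) : Matrix (Fin N) (Fin 2) ℂ := Matrix.of fun n k => ![a n, b n] k

/-- The smallest eigenvalue of the `2 × 2` Gram matrix `Xᴴ X`. -/
def gramMin {N : ℕ} (X : Matrix (Fin N) (Fin 2) ℂ) : ℝ :=
  ⨅ k : Fin 2, (Matrix.isHermitian_conjTranspose_mul_self X).eigenvalues k

/-- `‖d‖² ≥̇ ρ ^ (c + ε)` for all `d ∈ D ρ`, for some `ε ≥ 0`. -/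
def NormCriterion {N : ℕ} (D : ℝ → Set (V N)) (c : ℝ) : Prop :=
  ∃ ε : ℝ, 0 ≤ ε ∧ ExpGE (fun ρ => {v | ∃ d ∈ D ρ, v = ‖d‖ ^ 2}) (c + ε)

/-- The smallest eigenvalue of the Gram matrix of `[d d']` is `≥̇ ρ ^ (c + ε)` for all `d ∈ D ρ`,
`d' ∈ D' ρ`, for some `ε ≥ 0`. -/
def GramCriterion {N : ℕ} (D D' : ℝ → Set (V N)) (c : ℝ) : Prop :=
  ∃ ε : ℝ, 0 ≤ ε ∧
    ExpGE (fun ρ => {v | ∃ d ∈ D ρ, ∃ d' ∈ D' ρ, v = gramMin (stack d d')}) (c + ε)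

/-- The criteria of multiple-access type; `Γ i` is the rate pair attached to the `i`-th exponent
(`Γ 0`, `Γ 1` for the two single-user exponents, `Γ 2` for the joint one). -/
structure MACCriteria {N : ℕ} (Γ : Fin 3 → Fin 2 → ℝ) (C : Fin 2 → ℝ → Finset (V N)) :
    Prop where
  user1 : NormCriterion (diffs (C 0)) (-Γ 0 0)
  user2 : NormCriterion (diffs (C 1)) (-Γ 1 1)
  joint : GramCriterion (diffs (C 0)) (diffs (C 1)) (-Γ 2 0 - Γ 2 1)

/-- The criteria for superposition codes; `Υ n m` and `Ψ n m` are the total-rate and private-rate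
pairs attached to the exponent `d_{n,m+1}`. -/
structure SuperpositionCriteria {N : ℕ} (p : Fin 2 → ℝ) (Υ Ψ : Fin 2 → Fin 6 → Fin 2 → ℝ)
    (Cu Cw : Fin 2 → ℝ → Finset (V N)) : Prop where
  priv : ∀ i, NormCriterion (privateDiffs (p i) (Cu i)) (-Ψ i 0 i)
  pub : ∀ i, NormCriterion (diffs (Cw i)) (-Υ i 1 i + Ψ i 1 i)
  combined : ∀ i, NormCriterion (combinedDiffs (Cu i) (Cw i)) (-Υ i 2 i)
  privPub : ∀ i, GramCriterion (privateDiffs (p i) (Cu i)) (diffs (Cw (other i)))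
    (-Ψ i 3 i - Υ i 3 (other i) + Ψ i 3 (other i))
  pubPub : ∀ i, GramCriterion (diffs (Cw i)) (diffs (Cw (other i)))
    (-(∑ k, Υ i 4 k) + ∑ k, Ψ i 4 k)
  combinedPub : ∀ i, GramCriterion (combinedDiffs (Cu i) (Cw i)) (diffs (Cw (other i)))
    (-Υ i 5 i - Υ i 5 (other i) + Ψ i 5 (other i))

/-- The power constraints of the fixed power split with private power exponents `p`. -/
def PowerSplit {N : ℕ} (p : Fin 2 → ℝ) (Cu Cw : Fin 2 → ℝ → Finset (V N)) : Prop :=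
  ∀ i, ∀ ρ : ℝ, 1 < ρ →
    (∀ u ∈ Cu i ρ, ‖u‖ ≤ √(N / ρ ^ (1 - p i))) ∧
    (∀ w ∈ Cw i ρ, ‖w‖ ≤ √N * (1 - √(1 / ρ ^ (1 - p i))))

end FadingIC

end

noncomputable section

namespace FadingIC

/-! ### Gaussian laws -/

/-! Errors are controlled by a deterministic statement about the decoder, with no union bound over
codeword pairs. If a wrong own message is at least as likely as the true one, the received
difference signal has energy at most a constant times `ρ ^ δ + ρ ^ (α - 1 + p') * ‖h.2‖ ^ 2`, unless
the noise is atypically large (`norm_signal_sq_le`). Treating the undecoded message as noise costs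
only the logarithm of its codebook size, which is subpolynomial in `ρ`.

The separation criteria bound that same energy below by powers of `ρ` times the squared moduli of
the fading coefficients, uniformly over the pairs. So all errors of one type lie in a single event
on the two coefficients. Its exponent comes from `P(|h|² ≤ x) ≤ x`: either the direct link alone
must fade (`outageLE_direct_fade`), or both links must (`outageLE_double_fade`), the latter when
residual interference is weaker than the separated cross term.

Six error types, according to which of the own private, own public and interfering public messages
are wrong, give the six exponents at each receiver (`expLE_rxErrorProb`). The auxiliary rate pairs
enter only through the separation exponents, at which the corresponding `dkl` or `dMUi` is
evaluated. -/

lemma integrable_exp_neg_mul_sq_norm {b : ℝ} (hb : 0 < b) :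
    Integrable fun z : ℂ => Real.exp (-b * ‖z‖ ^ 2) := by
  have h := GaussianFourier.integral_rexp_neg_mul_sq_norm (V := ℂ) hb
  -- A non-integrable function would have integral zero by convention, against the positive Gaussian
  -- value.
  by_contra hn
  rw [integral_undef hn] at h
  have : 0 < (Real.pi / b) ^ ((Module.finrank ℝ ℂ : ℝ) / 2) := by positivity
  linarith

lemma lintegral_exp_neg_mul_sq_norm {b : ℝ} (hb : 0 < b) :
    ∫⁻ z : ℂ, ENNReal.ofReal (Real.pi⁻¹ * Real.exp (-b * ‖z‖ ^ 2)) = ENNReal.ofReal b⁻¹ := by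
  rw [← ofReal_integral_eq_lintegral_ofReal
    ((integrable_exp_neg_mul_sq_norm hb).const_mul _) (.of_forall fun z => by positivity),
    integral_const_mul, GaussianFourier.integral_rexp_neg_mul_sq_norm hb]
  congr 1
  rw [Complex.finrank_real_complex]
  norm_num
  field_simp

instance : IsProbabilityMeasure cn := by
  constructor
  have h := lintegral_exp_neg_mul_sq_norm one_pos
  simp only [neg_mul, one_mul, inv_one, ENNReal.ofReal_one] at h
  rw [cn, withDensity_apply _ .univ, Measure.restrict_univ, h]

instance (N : ℕ) : IsProbabilityMeasure (cnVec N) :=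
  Measure.isProbabilityMeasure_map (by fun_prop)

/-- The density is at most `π⁻¹` and the disc has area `π x`. -/
lemma cn_real_norm_sq_le {x : ℝ} (hx : 0 ≤ x) : cn.real {h | ‖h‖ ^ 2 ≤ x} ≤ x := by
  refine ENNReal.toReal_le_of_le_ofReal hx ?_
  have hs : {h : ℂ | ‖h‖ ^ 2 ≤ x} = Metric.closedBall 0 (√x) := by
    ext h
    simp [Real.le_sqrt (norm_nonneg h) hx]
  rw [hs, cn, withDensity_apply _ Metric.isClosed_closedBall.measurableSet]
  calc _ ≤ ∫⁻ _ in Metric.closedBall (0 : ℂ) (√x), ENNReal.ofReal Real.pi⁻¹ := by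
        refine lintegral_mono fun z => ENNReal.ofReal_le_ofReal ?_
        exact mul_le_of_le_one_right (by positivity) (Real.exp_le_one_iff.2 (by simp))
    _ = ENNReal.ofReal x := by
        rw [lintegral_const, Measure.restrict_apply_univ, Complex.volume_closedBall,
          ← ENNReal.ofReal_pow (by positivity), Real.sq_sqrt hx,
          ← ENNReal.ofReal_coe_nnreal, ← ENNReal.ofReal_mul hx,
          ← ENNReal.ofReal_mul (by positivity), NNReal.coe_real_pi]
        congr 1
        field_simp

/-- Half of the exponent is bounded by its value at the threshold; the other half integrates to 2.
The resulting constant is not sharp, but only superpolynomial decay matters. -/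
lemma cn_real_lt_norm_sq_le (x : ℝ) : cn.real {h | x < ‖h‖ ^ 2} ≤ 2 * Real.exp (-(x / 2)) := by
  refine ENNReal.toReal_le_of_le_ofReal (by positivity) ?_
  have hm : MeasurableSet {h : ℂ | x < ‖h‖ ^ 2} := measurableSet_lt (by fun_prop) (by fun_prop)
  rw [cn, withDensity_apply _ hm]
  calc _ ≤ ∫⁻ z in {h : ℂ | x < ‖h‖ ^ 2}, ENNReal.ofReal (Real.exp (-(x / 2))) *
          ENNReal.ofReal (Real.pi⁻¹ * Real.exp (-(1 / 2) * ‖z‖ ^ 2)) := by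
        refine setLIntegral_mono' hm fun z hz => ?_
        rw [← ENNReal.ofReal_mul (by positivity), mul_left_comm, ← Real.exp_add]
        refine ENNReal.ofReal_le_ofReal ?_
        gcongr
        have : x < ‖z‖ ^ 2 := hz
        linarith
    _ ≤ ∫⁻ z, ENNReal.ofReal (Real.exp (-(x / 2))) *
          ENNReal.ofReal (Real.pi⁻¹ * Real.exp (-(1 / 2) * ‖z‖ ^ 2)) := setLIntegral_le_lintegral _ _
    _ = ENNReal.ofReal (2 * Real.exp (-(x / 2))) := by
        rw [lintegral_const_mul' _ _ ENNReal.ofReal_ne_top,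
          lintegral_exp_neg_mul_sq_norm (by norm_num), ← ENNReal.ofReal_mul (by positivity)]
        norm_num [mul_comm]

/-- A sum of `N` terms above `N * x` has a term above `x`; a union bound over coordinates finishes.
-/
lemma cnVec_real_lt_norm_sq_le (N : ℕ) (x : ℝ) :
    (cnVec N).real {z | N * x < ‖z‖ ^ 2} ≤ N * (2 * Real.exp (-(x / 2))) := by
  have hm : MeasurableSet {z : V N | N * x < ‖z‖ ^ 2} :=
    measurableSet_lt (by fun_prop) (by fun_prop)
  rw [cnVec, map_measureReal_apply (by fun_prop) hm]
  have hsub : WithLp.toLp 2 ⁻¹' {z : V N | N * x < ‖z‖ ^ 2} ⊆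
      ⋃ k, Function.eval k ⁻¹' {h : ℂ | x < ‖h‖ ^ 2} := by
    intro z hz
    simp only [Set.mem_preimage, Set.mem_ofPred_eq, EuclideanSpace.norm_sq_eq] at hz
    by_contra hc
    simp only [Set.mem_iUnion, Set.mem_preimage, Set.mem_ofPred_eq, not_exists, not_lt,
      Function.eval] at hc
    have := Finset.sum_le_sum fun k (_ : k ∈ Finset.univ) => hc k
    simp only [Finset.sum_const, Finset.card_univ, Fintype.card_fin, nsmul_eq_mul] at this
    linarith
  refine (measureReal_mono hsub).trans ((measureReal_iUnion_fintype_le _).trans ?_)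
  refine (Finset.sum_le_card_nsmul _ _ (2 * Real.exp (-(x / 2))) fun k _ => ?_).trans_eq (by simp)
  have hk : MeasurableSet {h : ℂ | x < ‖h‖ ^ 2} := measurableSet_lt (by fun_prop) (by fun_prop)
  rw [measureReal_def,
    (measurePreserving_eval (fun _ : Fin N => cn) k).measure_preimage hk.nullMeasurableSet]
  exact cn_real_lt_norm_sq_le x

/-! ### Probabilities with a given SNR exponent -/

/-- The events `S δ ρ` have probability `≤̇ ρ ^ (-d)`, up to a loss in the exponent that vanishes
as the slack `δ` tends to zero. -/
def OutageLE {Ω : Type*} [MeasurableSpace Ω] (μ : Measure Ω) (S : ℝ → ℝ → Set Ω) (d : ℝ) : Prop :=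
  ∀ η : ℝ, 0 < η → ∀ᶠ δ in 𝓝[>] 0, ∀ᶠ ρ in atTop, μ.real (S δ ρ) ≤ ρ ^ (-d + η)

lemma eventually_le_rpow (K : ℝ) {a : ℝ} (ha : 0 < a) : ∀ᶠ ρ : ℝ in atTop, K ≤ ρ ^ a :=
  (tendsto_rpow_atTop ha).eventually_ge_atTop K

/-- Exponential decay in `ρ ^ δ` beats the power `c / δ` of `ρ ^ δ`, which is `ρ ^ c`. -/
lemma eventually_mul_exp_le_rpow (K c : ℝ) {b δ : ℝ} (hb : 0 < b) (hδ : 0 < δ) :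
    ∀ᶠ ρ : ℝ in atTop, K * Real.exp (-(b * ρ ^ δ)) ≤ ρ ^ c := by
  have h := ((isLittleO_exp_neg_mul_rpow_atTop hb (c / δ)).const_mul_left K).comp_tendsto
    (tendsto_rpow_atTop hδ)
  filter_upwards [h.bound one_pos, eventually_gt_atTop 0] with ρ h1 h0
  simp only [Function.comp, one_mul] at h1
  rw [← Real.rpow_mul h0.le, mul_div_cancel₀ _ hδ.ne',
    Real.norm_of_nonneg (Real.rpow_nonneg h0.le c), neg_mul] at h1
  exact (Real.le_norm_self _).trans h1

section

variable {Ω Ω' : Type*} [MeasurableSpace Ω] [MeasurableSpace Ω'] {μ : Measure Ω}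
  {S T : ℝ → ℝ → Set Ω} {d : ℝ}

lemma OutageLE.mono [IsFiniteMeasure μ] (hT : OutageLE μ T d)
    (h : ∀ᶠ δ in 𝓝[>] 0, ∀ᶠ ρ in atTop, S δ ρ ⊆ T δ ρ) : OutageLE μ S d := by
  intro η hη
  filter_upwards [hT η hη, h] with δ h1 h2
  filter_upwards [h1, h2] with ρ h1 h2
  exact (measureReal_mono h2).trans h1

/-- The factor 2 of the union bound is absorbed by `ρ ^ (η / 2)`. -/
lemma OutageLE.union (hS : OutageLE μ S d) (hT : OutageLE μ T d) :
    OutageLE μ (fun δ ρ => S δ ρ ∪ T δ ρ) d := by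
  intro η hη
  filter_upwards [hS (η / 2) (half_pos hη), hT (η / 2) (half_pos hη)] with δ h1 h2
  filter_upwards [h1, h2, eventually_gt_atTop 0, eventually_le_rpow 2 (half_pos hη)]
    with ρ h1 h2 h0 h3
  calc μ.real (S δ ρ ∪ T δ ρ) ≤ 2 * ρ ^ (-d + η / 2) := by
        linarith [measureReal_union_le (μ := μ) (S δ ρ) (T δ ρ)]
    _ ≤ ρ ^ (η / 2) * ρ ^ (-d + η / 2) := by gcongr
    _ = ρ ^ (-d + η) := by rw [← Real.rpow_add h0]; congr 1; ring

lemma OutageLE.of_nonpos [IsProbabilityMeasure μ] (hd : d ≤ 0) : OutageLE μ S d := by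
  intro η hη
  filter_upwards with δ
  filter_upwards [eventually_ge_atTop 1] with ρ hρ
  exact measureReal_le_one.trans (Real.one_le_rpow hρ (by linarith))

lemma OutageLE.of_empty (h : ∀ δ ρ, S δ ρ = ∅) : OutageLE μ S d := by
  intro η _
  filter_upwards with δ
  filter_upwards [eventually_ge_atTop 0] with ρ hρ
  simp only [h, measureReal_empty]
  positivity

lemma OutageLE.anti {d' : ℝ} (hS : OutageLE μ S d) (h : d' ≤ d) : OutageLE μ S d' := by
  intro η hη
  filter_upwards [hS η hη] with δ h1
  filter_upwards [h1, eventually_ge_atTop 1] with ρ h1 h2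
  exact h1.trans (Real.rpow_le_rpow_of_exponent_le h2 (by linarith))

lemma OutageLE.prod {ν : Measure Ω'} [IsFiniteMeasure μ] [IsFiniteMeasure ν]
    {T : ℝ → ℝ → Set Ω'} {d' : ℝ} (hS : OutageLE μ S d) (hT : OutageLE ν T d') :
    OutageLE (μ.prod ν) (fun δ ρ => S δ ρ ×ˢ T δ ρ) (d + d') := by
  intro η hη
  filter_upwards [hS (η / 2) (half_pos hη), hT (η / 2) (half_pos hη)] with δ h1 h2
  filter_upwards [h1, h2, eventually_gt_atTop 0] with ρ h1 h2 h0
  rw [measureReal_prod_prod]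
  calc _ ≤ ρ ^ (-d + η / 2) * ρ ^ (-d' + η / 2) := by gcongr
    _ = ρ ^ (-(d + d') + η) := by rw [← Real.rpow_add h0]; congr 1; ring

lemma OutageLE.preimage_fst {ν : Measure Ω'} [IsFiniteMeasure μ] [IsProbabilityMeasure ν]
    (hS : OutageLE μ S d) : OutageLE (μ.prod ν) (fun δ ρ => Prod.fst ⁻¹' S δ ρ) d := by
  have h := hS.prod (OutageLE.of_nonpos (μ := ν) (S := fun _ _ => Set.univ) le_rfl)
  simpa [Set.prod_univ] using h

lemma OutageLE.preimage_snd {ν : Measure Ω'} [IsProbabilityMeasure ν] [IsFiniteMeasure μ]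
    (hS : OutageLE μ S d) : OutageLE (ν.prod μ) (fun δ ρ => Prod.snd ⁻¹' S δ ρ) d := by
  have h := (OutageLE.of_nonpos (μ := ν) (S := fun _ _ => Set.univ) le_rfl).prod hS
  simpa [Set.univ_prod] using h

end

/-- A `CN(0, 1)` coefficient has squared modulus at most `ρ ^ (-x)` with probability
`≤̇ ρ ^ (-x⁺)`. -/
lemma outageLE_cn_norm_sq_le (x k : ℝ) :
    OutageLE cn (fun δ ρ => {h | ‖h‖ ^ 2 ≤ ρ ^ (-x + k * δ)}) (max x 0) := by
  rcases le_total x 0 with hx | hx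
  · exact OutageLE.of_nonpos (by simp [hx])
  intro η hη
  have ht : Tendsto (fun δ => k * δ) (𝓝[>] 0) (𝓝 0) :=
    ((continuous_const_mul k).tendsto' 0 0 (by simp)).mono_left nhdsWithin_le_nhds
  filter_upwards [ht.eventually_lt_const hη] with δ hδ
  filter_upwards [eventually_ge_atTop 1] with ρ hρ
  refine (cn_real_norm_sq_le (by positivity)).trans ?_
  rw [max_eq_left hx]
  exact Real.rpow_le_rpow_of_exponent_le hρ (by linarith)

/-- The tail is smaller than every power of `ρ`, so the exponent is arbitrary and the event can be
discarded at no cost. -/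
lemma outageLE_cn_lt_norm_sq (d : ℝ) : OutageLE cn (fun δ ρ => {h | ρ ^ δ < ‖h‖ ^ 2}) d := by
  intro η hη
  filter_upwards [self_mem_nhdsWithin] with δ hδ
  filter_upwards [eventually_mul_exp_le_rpow 2 (-d + η) (b := 1 / 2) (by norm_num) hδ] with ρ h
  refine (cn_real_lt_norm_sq_le _).trans (le_trans (le_of_eq ?_) h)
  ring_nf

lemma outageLE_cnVec_lt_norm_sq (N : ℕ) (d : ℝ) :
    OutageLE (cnVec N) (fun δ ρ => {z | N * ρ ^ δ < ‖z‖ ^ 2}) d := by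
  intro η hη
  filter_upwards [self_mem_nhdsWithin] with δ hδ
  filter_upwards [eventually_mul_exp_le_rpow (N * 2) (-d + η) (b := 1 / 2) (by norm_num) hδ]
    with ρ h
  refine (cnVec_real_lt_norm_sq_le N _).trans (le_trans (le_of_eq ?_) h)
  ring_nf

/-! ### Separation of codeword differences -/

open scoped ComplexOrder Matrix in
-- Rayleigh quotient bound: the Gram matrix minus its smallest eigenvalue times the identity is
-- positive semidefinite, and it is evaluated at the vector `(x, y)`.
lemma gramMin_stack_mul_le {N : ℕ} (a b : V N) (x y : ℂ) :
    gramMin (stack a b) * (‖x‖ ^ 2 + ‖y‖ ^ 2) ≤ ‖x • a + y • b‖ ^ 2 := by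
  set A := (stack a b).conjTranspose * stack a b with hA
  have hH : A.IsHermitian := Matrix.isHermitian_conjTranspose_mul_self _
  set m := gramMin (stack a b) with hm
  have hle : ∀ k, m ≤ hH.eigenvalues k := fun k => ciInf_le (Set.finite_range _).bddBelow k
  have hpsd : (A - (m : ℂ) • (1 : Matrix (Fin 2) (Fin 2) ℂ)).PosSemidef := by
    rw [Matrix.posSemidef_iff_isHermitian_and_spectrum_nonneg]
    refine ⟨hH.sub (by simp [Matrix.IsHermitian, Matrix.conjTranspose_smul]), ?_⟩
    intro z hz
    rw [← Algebra.algebraMap_eq_smul_one, ← spectrum.sub_singleton_eq] at hz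
    obtain ⟨e, he, _, rfl, rfl⟩ := Set.mem_sub.1 hz
    rw [hH.spectrum_eq_image_range] at he
    obtain ⟨_, ⟨k, rfl⟩, rfl⟩ := he
    have := hle k
    exact sub_nonneg.2 (Complex.real_le_real.2 this)
  have h := hpsd.re_dotProduct_nonneg ![x, y]
  have hx : stack a b *ᵥ ![x, y] = WithLp.ofLp (x • a + y • b) := by
    ext n
    simp [stack, Matrix.mulVec, dotProduct, Fin.sum_univ_two, mul_comm]
  have hn : star ![x, y] ⬝ᵥ (A *ᵥ ![x, y]) = ((‖x • a + y • b‖ ^ 2 : ℝ) : ℂ) := by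
    rw [hA, ← Matrix.mulVec_mulVec, Matrix.dotProduct_mulVec, Matrix.vecMul_conjTranspose,
      star_star, hx, EuclideanSpace.norm_sq_eq]
    simp [dotProduct, ← Complex.conj_mul']
  have h1 : star ![x, y] ⬝ᵥ ![x, y] = ((‖x‖ ^ 2 + ‖y‖ ^ 2 : ℝ) : ℂ) := by
    simp [dotProduct, Fin.sum_univ_two, ← Complex.conj_mul']
  rw [Matrix.sub_mulVec, Matrix.smul_mulVec, Matrix.one_mulVec, dotProduct_sub,
    dotProduct_smul, hn, h1, smul_eq_mul, ← Complex.ofReal_mul, ← Complex.ofReal_sub] at h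
  exact sub_nonneg.1 h

/-- The vectors in `D ρ` have squared norm `≥̇ ρ ^ (-q)`. -/
def NormSep {N : ℕ} (D : ℝ → Set (V N)) (q : ℝ) : Prop :=
  ∀ δ : ℝ, 0 < δ → ∀ᶠ ρ in atTop, ∀ a ∈ D ρ, ρ ^ (-q - δ) ≤ ‖a‖ ^ 2

/-- The combinations `x • a + y • b` with `a ∈ D ρ` and `b ∈ D' ρ` have squared norm
`≥̇ ρ ^ (-q) (|x|² + |y|²)`. -/
def JointSep {N : ℕ} (D D' : ℝ → Set (V N)) (q : ℝ) : Prop :=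
  ∀ δ : ℝ, 0 < δ → ∀ᶠ ρ in atTop, ∀ a ∈ D ρ, ∀ b ∈ D' ρ, ∀ x y : ℂ,
    ρ ^ (-q - δ) * (‖x‖ ^ 2 + ‖y‖ ^ 2) ≤ ‖x • a + y • b‖ ^ 2

lemma NormCriterion.normSep {N : ℕ} {D : ℝ → Set (V N)} {c q : ℝ} (h : NormCriterion D c)
    (hq : c = -q) : NormSep D q := by
  obtain ⟨ε, hε, h⟩ := h
  intro δ hδ
  filter_upwards [h δ hδ, eventually_ge_atTop 1] with ρ h hρ a ha
  exact (Real.rpow_le_rpow_of_exponent_le hρ (by linarith)).trans (h _ ⟨a, ha, rfl⟩)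

lemma GramCriterion.jointSep {N : ℕ} {D D' : ℝ → Set (V N)} {c q : ℝ}
    (h : GramCriterion D D' c) (hq : c = -q) : JointSep D D' q := by
  obtain ⟨ε, hε, h⟩ := h
  intro δ hδ
  filter_upwards [h δ hδ, eventually_ge_atTop 1] with ρ h hρ a ha b hb x y
  refine le_trans ?_ (gramMin_stack_mul_le a b x y)
  gcongr
  exact (Real.rpow_le_rpow_of_exponent_le hρ (by linarith)).trans (h _ ⟨a, ha, b, hb, rfl⟩)

lemma JointSep.symm {N : ℕ} {D D' : ℝ → Set (V N)} {q : ℝ} (h : JointSep D D' q) :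
    JointSep D' D q := by
  intro δ hδ
  filter_upwards [h δ hδ] with ρ h a ha b hb x y
  rw [add_comm (x • a), add_comm (‖x‖ ^ 2)]
  exact h b hb a ha y x

/-! ### Channel outage -/

/-- The effective exponent of a joint error in two messages, where `c` is the power exponent of
the own message, `q` the joint rate and `p` the power exponent of the undecoded message. -/
def jointExponent (α c q p : ℝ) : ℝ :=
  if p < 1 - q then max (c - q) 0 + max (α - q) 0 else max (c - q - max (α - 1 + p) 0) 0

/-- The own signal `h₁ a`, received with power exponent `c`, is not stronger than noise and
residual interference. -/
def normOutage {N : ℕ} (D : ℝ → Set (V N)) (c β K δ ρ : ℝ) : Set (ℂ × ℂ) :=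
  {h | ∃ a ∈ D ρ, ‖((√(ρ ^ c) : ℂ) * h.1) • a‖ ^ 2 ≤ K * (ρ ^ δ + ρ ^ β * ‖h.2‖ ^ 2)}

/-- The joint signal `h₁ a + h₂ b` is not stronger than noise and residual interference. -/
def jointOutage {N : ℕ} (D D' : ℝ → Set (V N)) (α c β K δ ρ : ℝ) : Set (ℂ × ℂ) :=
  {h | ∃ a ∈ D ρ, ∃ b ∈ D' ρ,
    ‖((√(ρ ^ c) : ℂ) * h.1) • a + ((√(ρ ^ α) : ℂ) * h.2) • b‖ ^ 2 ≤
      K * (ρ ^ δ + ρ ^ β * ‖h.2‖ ^ 2)}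

lemma norm_sqrt_rpow_mul_sq {ρ : ℝ} (hρ : 0 ≤ ρ) (c : ℝ) (h : ℂ) :
    ‖(√(ρ ^ c) : ℂ) * h‖ ^ 2 = ρ ^ c * ‖h‖ ^ 2 := by
  rw [norm_mul, mul_pow, Complex.norm_real, Real.norm_of_nonneg (Real.sqrt_nonneg _),
    Real.sq_sqrt (by positivity)]

/-- Solving `ρ ^ (x - δ) A ≤ B` for `A`. -/
lemma le_rpow_of_rpow_mul_le {ρ A B x y δ : ℝ} (hρ : 0 < ρ) (h : ρ ^ (x - δ) * A ≤ B)
    (hB : B ≤ ρ ^ (y + 2 * δ)) : A ≤ ρ ^ (-(x - y) + 3 * δ) := by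
  have h1 : ρ ^ (-x + δ) * (ρ ^ (x - δ) * A) = A := by
    rw [← mul_assoc, ← Real.rpow_add hρ, show -x + δ + (x - δ) = 0 by ring, Real.rpow_zero,
      one_mul]
  calc A = ρ ^ (-x + δ) * (ρ ^ (x - δ) * A) := h1.symm
    _ ≤ ρ ^ (-x + δ) * ρ ^ (y + 2 * δ) := by gcongr; exact h.trans hB
    _ = _ := by rw [← Real.rpow_add hρ]; congr 1; ring

/-- A single fade: the direct link is too weak against noise and residual interference. -/
lemma outageLE_direct_fade (x β K : ℝ) (hK : 0 ≤ K) :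
    OutageLE (cn.prod cn)
      (fun δ ρ => {h | ρ ^ (x - δ) * ‖h.1‖ ^ 2 ≤ K * (ρ ^ δ + ρ ^ β * ‖h.2‖ ^ 2)})
      (max (x - max β 0) 0) := by
  refine ((outageLE_cn_norm_sq_le (x - max β 0) 3).preimage_fst.union
    (outageLE_cn_lt_norm_sq _).preimage_snd).mono ?_
  filter_upwards [self_mem_nhdsWithin] with δ hδ
  filter_upwards [eventually_ge_atTop 1, eventually_le_rpow (2 * K) hδ] with ρ hρ hKρ h hh
  have h0 : 0 < ρ := by linarith
  -- A cross link stronger than `ρ ^ δ` is negligible. Otherwise noise plus interference is at most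
  -- `ρ ^ (max β 0 + 2 * δ)`, the last `ρ ^ δ` absorbing `2 * K`.
  by_cases h2 : ρ ^ δ < ‖h.2‖ ^ 2
  · exact Or.inr h2
  refine Or.inl ?_
  push Not at h2
  refine le_rpow_of_rpow_mul_le h0 hh ?_
  have e1 : ρ ^ δ ≤ ρ ^ (max β 0 + δ) :=
    Real.rpow_le_rpow_of_exponent_le hρ (by linarith [le_max_right β 0])
  have e2 : ρ ^ β * ‖h.2‖ ^ 2 ≤ ρ ^ (max β 0 + δ) := by
    rw [Real.rpow_add h0]
    gcongr
    exact le_max_left _ _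
  calc K * (ρ ^ δ + ρ ^ β * ‖h.2‖ ^ 2) ≤ K * (ρ ^ (max β 0 + δ) + ρ ^ (max β 0 + δ)) := by gcongr
    _ = 2 * K * ρ ^ (max β 0 + δ) := by ring
    _ ≤ ρ ^ δ * ρ ^ (max β 0 + δ) := by gcongr
    _ = _ := by rw [← Real.rpow_add h0]; congr 1; ring

/-- A double fade: the joint signal is too weak, and residual interference does not limit the
cross link. -/
lemma outageLE_double_fade (x y β K : ℝ) (hβ : β < y) :
    OutageLE (cn.prod cn)
      (fun δ ρ => {h | ρ ^ (x - δ) * ‖h.1‖ ^ 2 + ρ ^ (y - δ) * ‖h.2‖ ^ 2 ≤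
        K * (ρ ^ δ + ρ ^ β * ‖h.2‖ ^ 2)})
      (max x 0 + max y 0) := by
  refine ((outageLE_cn_norm_sq_le x 3).prod (outageLE_cn_norm_sq_le y 3)).mono ?_
  -- Any bound on `δ` below `y - β` would do: what is needed is `0 < y - δ - β`.
  have hpos : 0 < (y - β) / 3 := by linarith
  filter_upwards [Ioo_mem_nhdsGT hpos] with δ hδ
  obtain ⟨hδ, hδ'⟩ := hδ
  filter_upwards [eventually_ge_atTop 1, eventually_le_rpow (2 * K) hδ,
    eventually_le_rpow (2 * K) (show 0 < y - δ - β by linarith)] with ρ hρ hKρ hKβ h hh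
  have h0 : 0 < ρ := by linarith
  have hh' : ρ ^ (x - δ) * ‖h.1‖ ^ 2 + ρ ^ (y - δ) * ‖h.2‖ ^ 2 ≤
      K * (ρ ^ δ + ρ ^ β * ‖h.2‖ ^ 2) := hh
  have n1 : 0 ≤ ρ ^ (x - δ) * ‖h.1‖ ^ 2 := by positivity
  -- Interference takes at most half of the cross term; the other half and the direct term remain,
  -- each bounded through the noise alone.
  have hint : 2 * K * (ρ ^ β * ‖h.2‖ ^ 2) ≤ ρ ^ (y - δ) * ‖h.2‖ ^ 2 := by
    rw [← mul_assoc]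
    gcongr
    calc 2 * K * ρ ^ β ≤ ρ ^ (y - δ - β) * ρ ^ β := by gcongr
      _ = ρ ^ (y - δ) := by rw [← Real.rpow_add h0]; congr 1; ring
  have hδ2 : 2 * K * ρ ^ δ ≤ ρ ^ (0 + 2 * δ) := by
    rw [zero_add, two_mul δ, Real.rpow_add h0]
    gcongr
  have n2 : 0 ≤ ρ ^ (y - δ) * ‖h.2‖ ^ 2 := by positivity
  have f1 := le_rpow_of_rpow_mul_le (A := ‖h.1‖ ^ 2) (x := x) (y := 0) (δ := δ) h0
    (B := 2 * K * ρ ^ δ) (by nlinarith) hδ2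
  have f2 := le_rpow_of_rpow_mul_le (A := ‖h.2‖ ^ 2) (x := y) (y := 0) (δ := δ) h0
    (B := 2 * K * ρ ^ δ) (by nlinarith) hδ2
  rw [sub_zero] at f1 f2
  exact ⟨f1, f2⟩

lemma NormSep.outageLE {N : ℕ} {D : ℝ → Set (V N)} {q : ℝ} (hD : NormSep D q) (c β : ℝ) {K : ℝ}
    (hK : 0 ≤ K) :
    OutageLE (cn.prod cn) (normOutage D c β K) (max (c - q - max β 0) 0) := by
  refine (outageLE_direct_fade (c - q) β K hK).mono ?_
  filter_upwards [self_mem_nhdsWithin] with δ hδ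
  filter_upwards [hD δ hδ, eventually_gt_atTop 0] with ρ hρ h0
  rintro h ⟨a, ha, hle⟩
  refine le_trans ?_ hle
  rw [norm_smul, mul_pow, norm_sqrt_rpow_mul_sq h0.le, show c - q - δ = c + (-q - δ) by ring,
    Real.rpow_add h0, mul_right_comm]
  gcongr
  exact hρ a ha

lemma JointSep.outageLE {N : ℕ} {D D' : ℝ → Set (V N)} {q : ℝ} (hD : JointSep D D' q)
    (α c p : ℝ) {K : ℝ} (hK : 0 ≤ K) :
    OutageLE (cn.prod cn) (jointOutage D D' α c (α - 1 + p) K) (jointExponent α c q p) := by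
  have key : ∀ᶠ δ in 𝓝[>] 0, ∀ᶠ ρ in atTop, jointOutage D D' α c (α - 1 + p) K δ ρ ⊆
      {h | ρ ^ (c - q - δ) * ‖h.1‖ ^ 2 + ρ ^ (α - q - δ) * ‖h.2‖ ^ 2 ≤
        K * (ρ ^ δ + ρ ^ (α - 1 + p) * ‖h.2‖ ^ 2)} := by
    filter_upwards [self_mem_nhdsWithin] with δ hδ
    filter_upwards [hD δ hδ, eventually_gt_atTop 0] with ρ hρ h0
    rintro h ⟨a, ha, b, hb, hle⟩
    refine le_trans (le_of_eq ?_) ((hρ a ha b hb _ _).trans hle)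
    rw [norm_sqrt_rpow_mul_sq h0.le, norm_sqrt_rpow_mul_sq h0.le,
      show c - q - δ = -q - δ + c by ring, show α - q - δ = -q - δ + α by ring,
      Real.rpow_add h0, Real.rpow_add h0]
    ring
  rw [jointExponent]
  -- The condition `p < 1 - q` says `α - 1 + p < α - q`: interference is weaker than the separated
  -- cross term. In the other case the cross term is dropped and only the direct fade counts.
  split_ifs with hp
  · exact (outageLE_double_fade (c - q) (α - q) (α - 1 + p) K (by linarith)).mono key
  · refine (outageLE_direct_fade (c - q) (α - 1 + p) K hK).mono ?_
    filter_upwards [key] with δ h1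
    filter_upwards [h1, eventually_gt_atTop 0] with ρ h1 h0 h hh
    have h2 : ρ ^ (c - q - δ) * ‖h.1‖ ^ 2 + ρ ^ (α - q - δ) * ‖h.2‖ ^ 2 ≤
        K * (ρ ^ δ + ρ ^ (α - 1 + p) * ‖h.2‖ ^ 2) := h1 hh
    refine le_trans ?_ h2
    have : 0 ≤ ρ ^ (α - q - δ) * ‖h.2‖ ^ 2 := by positivity
    linarith

/-! ### Decoding errors -/

/-- The true likelihood contains the term `exp (-‖z‖ ^ 2)`, while the competing one has `Cuj.card`
terms. If all of those were below `exp (-‖z‖ ^ 2) / Cuj.card`, the competitor would lose. -/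
lemma exists_norm_sq_le_of_likelihood_le {N : ℕ} {α ρ : ℝ} {Cuj : Finset (V N)} {h : ℂ × ℂ}
    {y z u w v u' u₁ w₁ v₁ : V N} (hu' : u' ∈ Cuj) (hy : y = signal α ρ h (u + w) (u' + v) + z)
    (hL : likelihood α ρ Cuj h y u w v ≤ likelihood α ρ Cuj h y u₁ w₁ v₁) :
    ∃ u'' ∈ Cuj, ‖y - signal α ρ h (u₁ + w₁) (u'' + v₁)‖ ^ 2 ≤ ‖z‖ ^ 2 + Real.log Cuj.card := by
  by_contra! hc
  have hcard : (0 : ℝ) < Cuj.card := by exact_mod_cast Finset.card_pos.2 ⟨u', hu'⟩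
  have h1 : Real.exp (-‖z‖ ^ 2) ≤ likelihood α ρ Cuj h y u w v := by
    refine le_trans (le_of_eq ?_) (Finset.single_le_sum
      (f := fun u' => Real.exp (-‖y - signal α ρ h (u + w) (u' + v)‖ ^ 2))
      (fun _ _ => (Real.exp_pos _).le) hu')
    simp [hy]
  have h2 : likelihood α ρ Cuj h y u₁ w₁ v₁ < Real.exp (-‖z‖ ^ 2) := by
    refine (Finset.sum_lt_sum_of_nonempty ⟨u', hu'⟩ (g := fun _ =>
      Real.exp (-(‖z‖ ^ 2 + Real.log Cuj.card))) fun x hx => ?_).trans_eq ?_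
    · rw [Real.exp_lt_exp]
      linarith [hc x hx]
    · rw [Finset.sum_const, nsmul_eq_mul, neg_add, Real.exp_add, Real.exp_neg (Real.log _),
        Real.exp_log hcard]
      field_simp
  linarith

lemma norm_sq_le_three_mul {E : Type*} [SeminormedAddCommGroup E] (t a b : E) :
    ‖t‖ ^ 2 ≤ 3 * (‖t + a + b‖ ^ 2 + ‖a‖ ^ 2 + ‖b‖ ^ 2) := by
  have h : ‖t‖ ≤ ‖t + a + b‖ + ‖a‖ + ‖b‖ := by
    calc ‖t‖ = ‖t + a + b - a - b‖ := by congr 1; abel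
      _ ≤ _ := (norm_sub_le _ _).trans (by gcongr; exact norm_sub_le _ _)
  nlinarith [norm_nonneg t, sq_nonneg (‖t + a + b‖ - ‖a‖), sq_nonneg (‖t + a + b‖ - ‖b‖),
    sq_nonneg (‖a‖ - ‖b‖)]

/-- The constant is `3 * 4 * N`: 3 from splitting a squared norm into signal, interference and noise
parts, and `4 * N` from the difference of two private codewords of bounded power. The noise part
needs only `9 * N`. -/
lemma norm_signal_sq_le {N : ℕ} (hN : 1 ≤ N) {α ρ δ p : ℝ} (hρ : 1 < ρ) {Cuj : Finset (V N)}
    {h : ℂ × ℂ} {z u w v u' u₁ w₁ v₁ : V N} (hu' : u' ∈ Cuj)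
    (hpow : ∀ u ∈ Cuj, ‖u‖ ≤ √(N / ρ ^ (1 - p))) (hlog : Real.log Cuj.card ≤ ρ ^ δ)
    (hz : ‖z‖ ^ 2 ≤ N * ρ ^ δ)
    (hL : likelihood α ρ Cuj h (signal α ρ h (u + w) (u' + v) + z) u w v ≤
      likelihood α ρ Cuj h (signal α ρ h (u + w) (u' + v) + z) u₁ w₁ v₁) :
    ‖signal α ρ h (u + w - (u₁ + w₁)) (v - v₁)‖ ^ 2 ≤
      12 * N * (ρ ^ δ + ρ ^ (α - 1 + p) * ‖h.2‖ ^ 2) := by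
  have h0 : 0 < ρ := by linarith
  obtain ⟨u'', hu'', hle⟩ := exists_norm_sq_le_of_likelihood_le hu' rfl hL
  set I : V N := ((√(ρ ^ α) : ℂ) * h.2) • (u' - u'') with hI
  have hdec : signal α ρ h (u + w) (u' + v) + z - signal α ρ h (u₁ + w₁) (u'' + v₁) =
      signal α ρ h (u + w - (u₁ + w₁)) (v - v₁) + I + z := by
    simp only [signal, hI]
    module
  rw [hdec] at hle
  have hInorm : ‖I‖ ^ 2 ≤ 4 * N * (ρ ^ (α - 1 + p) * ‖h.2‖ ^ 2) := by
    have hu : ‖u' - u''‖ ^ 2 ≤ 4 * (N / ρ ^ (1 - p)) := by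
      have h1 : ‖u' - u''‖ ≤ 2 * √(N / ρ ^ (1 - p)) := by
        linarith [norm_sub_le u' u'', hpow u' hu', hpow u'' hu'']
      calc ‖u' - u''‖ ^ 2 ≤ (2 * √(N / ρ ^ (1 - p))) ^ 2 := by gcongr
        _ = _ := by rw [mul_pow, Real.sq_sqrt (by positivity)]; norm_num
    rw [hI, norm_smul, mul_pow, norm_sqrt_rpow_mul_sq h0.le]
    calc _ ≤ ρ ^ α * ‖h.2‖ ^ 2 * (4 * (N / ρ ^ (1 - p))) := by gcongr
      _ = _ := by
        rw [show α - 1 + p = α - (1 - p) by ring, Real.rpow_sub h0 α]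
        ring
  have h3 := norm_sq_le_three_mul (signal α ρ h (u + w - (u₁ + w₁)) (v - v₁)) I z
  have hδ : 0 < ρ ^ δ := by positivity
  have hN' : ρ ^ δ ≤ N * ρ ^ δ :=
    le_mul_of_one_le_left (by positivity) (by exact_mod_cast hN)
  linarith

lemma IsCodebookSeq.eventually_log_card_le {N : ℕ} {r : ℝ} {C : ℝ → Finset (V N)}
    (hC : IsCodebookSeq r C) {δ : ℝ} (hδ : 0 < δ) :
    ∀ᶠ ρ in atTop, Real.log (C ρ).card ≤ ρ ^ δ := by
  have hlog := ((isLittleO_log_rpow_atTop hδ).const_mul_left (N * r + 1)).bound one_pos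
  filter_upwards [hC.rate.eventually_lt_const (lt_add_one _), hlog, eventually_gt_atTop 1]
    with ρ h1 h2 h3
  have hl : 0 < Real.log ρ := Real.log_pos h3
  rw [div_lt_iff₀ hl] at h1
  rw [one_mul, Real.norm_of_nonneg (Real.rpow_nonneg (by linarith) δ)] at h2
  exact h1.le.trans ((Real.le_norm_self _).trans h2)

lemma rxErrorProb_le {N : ℕ} {α ρ B : ℝ} {Cu Cw : Fin 2 → Finset (V N)} {i : Fin 2}
    (hB : 0 ≤ B)
    (h : ∀ u ∈ Cu i, ∀ w ∈ Cw i, ∀ u' ∈ Cu (other i), ∀ v ∈ Cw (other i),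
      ((cn.prod cn).prod (cnVec N)).real
        {ω | DecodingError α ρ Cu Cw i ω.1 (signal α ρ ω.1 (u + w) (u' + v) + ω.2) u w} ≤ B) :
    rxErrorProb α ρ Cu Cw i ≤ B := by
  rw [rxErrorProb]
  refine inv_mul_le_of_le_mul₀ (by positivity) hB ?_
  calc _ ≤ ∑ u ∈ Cu i, ∑ w ∈ Cw i, ∑ u' ∈ Cu (other i), ∑ v ∈ Cw (other i), B :=
        Finset.sum_le_sum fun u hu => Finset.sum_le_sum fun w hw => Finset.sum_le_sum
          fun u' hu' => Finset.sum_le_sum fun v hv => h u hu w hw u' hu' v hv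
    _ = _ := by
        simp only [Finset.sum_const, nsmul_eq_mul]
        ring

/-- If the six channel outage events of receiver `i` (errors in the private, public or both own
messages, without or with an error in the interfering public message) have exponent `d`, then so
does the error probability. -/
lemma expLE_rxErrorProb {N : ℕ} (hN : 1 ≤ N) {α : ℝ} {i : Fin 2} {Cu Cw : Fin 2 → ℝ → Finset (V N)}
    {p p' d : ℝ}
    (hpow : ∀ ρ : ℝ, 1 < ρ → ∀ u ∈ Cu (other i) ρ, ‖u‖ ≤ √(N / ρ ^ (1 - p')))
    (hlog : ∀ δ : ℝ, 0 < δ → ∀ᶠ ρ in atTop, Real.log (Cu (other i) ρ).card ≤ ρ ^ δ)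
    (hu : OutageLE (cn.prod cn)
      (normOutage (privateDiffs p (Cu i)) p (α - 1 + p') (12 * N)) d)
    (hw : OutageLE (cn.prod cn) (normOutage (diffs (Cw i)) 1 (α - 1 + p') (12 * N)) d)
    (hx : OutageLE (cn.prod cn)
      (normOutage (combinedDiffs (Cu i) (Cw i)) 1 (α - 1 + p') (12 * N)) d)
    (huv : OutageLE (cn.prod cn) (jointOutage (privateDiffs p (Cu i)) (diffs (Cw (other i)))
      α p (α - 1 + p') (12 * N)) d)
    (hwv : OutageLE (cn.prod cn) (jointOutage (diffs (Cw i)) (diffs (Cw (other i)))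
      α 1 (α - 1 + p') (12 * N)) d)
    (hxv : OutageLE (cn.prod cn) (jointOutage (combinedDiffs (Cu i) (Cw i))
      (diffs (Cw (other i))) α 1 (α - 1 + p') (12 * N)) d) :
    ExpLE (fun ρ => rxErrorProb α ρ (fun i => Cu i ρ) (fun i => Cw i ρ) i) (-d) := by
  intro η hη
  have hout := ((hu.union (hw.union hx)).union (huv.union (hwv.union hxv))).preimage_fst.union
    ((outageLE_cnVec_lt_norm_sq N d).preimage_snd (ν := cn.prod cn))
  -- Given the tolerance `η`, one sufficiently small slack `δ` serves all six channel events and the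
  -- noise event.
  obtain ⟨δ, hδ, hδ0⟩ := ((hout η hη).and self_mem_nhdsWithin).exists
  filter_upwards [hδ, hlog δ hδ0, eventually_gt_atTop 1] with ρ hprob hlogρ hρ
  have h0 : 0 < ρ := by linarith
  refine rxErrorProb_le (by positivity) fun u hu w hw u' hu' v hv =>
    (measureReal_mono ?_).trans hprob
  rintro ⟨h, z⟩ ⟨u₁, hu₁, w₁, hw₁, v₁, hv₁, hne, hL⟩
  by_cases hz : N * ρ ^ δ < ‖z‖ ^ 2
  · exact Or.inr hz
  refine Or.inl ?_
  have hS := norm_signal_sq_le hN hρ hu' (hpow ρ hρ) hlogρ (not_lt.1 hz) (hL v hv)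
  -- The rescaling of private differences moves the factor `ρ ^ (1 - p)` into the codeword, leaving
  -- received power exponent `p`.
  have hsqrt : (√(ρ ^ p) : ℂ) * (√(ρ ^ (1 - p)) : ℂ) = (√ρ : ℂ) := by
    rw [← Complex.ofReal_mul, ← Real.sqrt_mul (by positivity), ← Real.rpow_add h0]
    simp
  have hpriv : ((√(ρ ^ p) : ℂ) * h.1) • ((√(ρ ^ (1 - p)) : ℂ) • (u - u₁)) =
      ((√ρ : ℂ) * h.1) • (u - u₁) := by
    rw [smul_smul, ← hsqrt]
    ring_nf
  by_cases h1 : u = u₁ <;> by_cases h2 : w = w₁ <;> by_cases h3 : v = v₁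
  · exact absurd (by rw [h1, h2]) hne
  · exact absurd (by rw [h1, h2]) hne
  · refine Or.inl (Or.inr (Or.inl ⟨w - w₁, ⟨w, hw, w₁, hw₁, h2, rfl⟩, ?_⟩))
    simpa [signal, h1, h3] using hS
  · refine Or.inr (Or.inr (Or.inl ⟨w - w₁, ⟨w, hw, w₁, hw₁, h2, rfl⟩, v - v₁,
      ⟨v, hv, v₁, hv₁, h3, rfl⟩, ?_⟩))
    simpa [signal, h1] using hS
  · refine Or.inl (Or.inl ⟨_, ⟨u, hu, u₁, hu₁, h1, rfl⟩, ?_⟩)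
    rw [hpriv]
    simpa [signal, h2, h3] using hS
  · refine Or.inr (Or.inl ⟨_, ⟨u, hu, u₁, hu₁, h1, rfl⟩, v - v₁,
      ⟨v, hv, v₁, hv₁, h3, rfl⟩, ?_⟩)
    rw [hpriv]
    simpa [signal, h2] using hS
  · refine Or.inl (Or.inr (Or.inr ⟨u + w - (u₁ + w₁),
      ⟨u, hu, u₁, hu₁, w, hw, w₁, hw₁, h1, h2, rfl⟩, ?_⟩))
    simpa [signal, h3] using hS
  · refine Or.inr (Or.inr (Or.inr ⟨u + w - (u₁ + w₁),
      ⟨u, hu, u₁, hu₁, w, hw, w₁, hw₁, h1, h2, rfl⟩, v - v₁, ⟨v, hv, v₁, hv₁, h3, rfl⟩, ?_⟩))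
    simpa [signal] using hS

/-! ### The exponents of the superposition scheme in closed form -/

section

variable (α : ℝ) (i : Fin 2) (r s p : Fin 2 → ℝ)

/-- The threshold `1 - α` is where the residual interference exponent `α - 1 + p (other i)` changes
sign, so both branches are values of one positive part. -/
lemma d1_eq : d1 α i r s p = max (p i - s i - max (α - 1 + p (other i)) 0) 0 := by
  unfold d1
  split_ifs with h
  · rw [max_eq_right (a := α - 1 + p (other i)) (by linarith), sub_zero]
  · rw [max_eq_left (a := α - 1 + p (other i)) (by linarith)]
    ring_nf

lemma d2_eq : d2 α i r s p = max (1 - (r i - s i) - max (α - 1 + p (other i)) 0) 0 := by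
  unfold d2
  split_ifs with h
  · rw [max_eq_right (a := α - 1 + p (other i)) (by linarith)]
    ring_nf
  · rw [max_eq_left (a := α - 1 + p (other i)) (by linarith)]
    ring_nf

lemma d3_eq : d3 α i r s p = max (1 - r i - max (α - 1 + p (other i)) 0) 0 := by
  unfold d3
  split_ifs with h
  · rw [max_eq_right (a := α - 1 + p (other i)) (by linarith), sub_zero]
  · rw [max_eq_left (a := α - 1 + p (other i)) (by linarith)]
    ring_nf

lemma jointExponent_eq (c q p : ℝ) :
    jointExponent α c q p = if p < 1 - q then max (c - q) 0 + max (α - q) 0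
      else if p < 1 - α then max (c - q) 0 else max (1 - α - p + c - q) 0 := by
  unfold jointExponent
  split_ifs with h1 h2
  · rfl
  · rw [max_eq_right (a := α - 1 + p) (by linarith), sub_zero]
  · rw [max_eq_left (a := α - 1 + p) (by linarith)]
    ring_nf

lemma d4_eq : d4 α i r s p =
    jointExponent α (p i) (s i + r (other i) - s (other i)) (p (other i)) := by
  rw [d4, jointExponent_eq]
  congr! 2 <;> ring_nf

lemma d5_eq : d5 α i r s p = jointExponent α 1 ((∑ k, r k) - ∑ k, s k) (p (other i)) := by
  rw [d5, jointExponent_eq]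
  congr! 2 <;> ring_nf

lemma d6_eq : d6 α i r s p =
    jointExponent α 1 (r i + r (other i) - s (other i)) (p (other i)) := by
  rw [d6, jointExponent_eq]
  congr! 2 <;> ring_nf

end

/-! ### Achievability -/

lemma ExpLE.errorProb {N : ℕ} {α c : ℝ} {Cu Cw : Fin 2 → ℝ → Finset (V N)}
    (h : ∀ i, ExpLE (fun ρ => rxErrorProb α ρ (fun i => Cu i ρ) (fun i => Cw i ρ) i) c) :
    ExpLE (fun ρ => errorProb α ρ (fun i => Cu i ρ) (fun i => Cw i ρ)) c := by
  intro δ hδ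
  filter_upwards [h 0 δ hδ, h 1 δ hδ] with ρ h0 h1
  exact max_le h0 h1

lemma expLE_errorProb_superposition {N : ℕ} (hN : 1 ≤ N) {α d : ℝ} {s p : Fin 2 → ℝ}
    {Υ Ψ : Fin 2 → Fin 6 → Fin 2 → ℝ} (hd : ∀ n m, d ≤ dkl α n m (Υ n m) (Ψ n m) p)
    {Cu Cw : Fin 2 → ℝ → Finset (V N)} (hCu : ∀ i, IsCodebookSeq (s i) (Cu i))
    (hP : PowerSplit p Cu Cw) (hS : SuperpositionCriteria p Υ Ψ Cu Cw) :
    ExpLE (fun ρ => errorProb α ρ (fun i => Cu i ρ) (fun i => Cw i ρ)) (-d) := by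
  refine ExpLE.errorProb fun i => ?_
  have hK : (0 : ℝ) ≤ 12 * N := by positivity
  refine expLE_rxErrorProb hN (p := p i) (p' := p (other i)) (fun ρ hρ => (hP (other i) ρ hρ).1)
    (fun δ hδ => (hCu (other i)).eventually_log_card_le hδ) ?_ ?_ ?_ ?_ ?_ ?_
  · exact (((hS.priv i).normSep rfl).outageLE _ _ hK).anti
      ((hd i 0).trans_eq (d1_eq α i (Υ i 0) (Ψ i 0) p))
  · exact (((hS.pub i).normSep (by ring)).outageLE _ _ hK).anti ((hd i 1).trans_eq (d2_eq ..))
  · exact (((hS.combined i).normSep rfl).outageLE _ _ hK).anti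
      ((hd i 2).trans_eq (d3_eq α i (Υ i 2) (Ψ i 2) p))
  · exact (((hS.privPub i).jointSep (by ring)).outageLE _ _ _ hK).anti
      ((hd i 3).trans_eq (d4_eq ..))
  · exact (((hS.pubPub i).jointSep (by ring)).outageLE _ _ _ hK).anti
      ((hd i 4).trans_eq (d5_eq ..))
  · exact (((hS.combinedPub i).jointSep (by ring)).outageLE _ _ _ hK).anti
      ((hd i 5).trans_eq (d6_eq ..))

lemma privateDiffs_zero {N : ℕ} (p ρ : ℝ) : privateDiffs (N := N) p (fun _ => {0}) ρ = ∅ := by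
  ext d
  simp [privateDiffs]

lemma combinedDiffs_zero {N : ℕ} (C : ℝ → Finset (V N)) (ρ : ℝ) :
    combinedDiffs (fun _ => {0}) C ρ = ∅ := by
  ext d
  simp [combinedDiffs]

/-- With public messages only, there is no residual interference: any `p'` is a valid power
exponent for the zero codebook. -/
lemma expLE_rxErrorProb_public {N : ℕ} (hN : 1 ≤ N) {α d q q' : ℝ} {i : Fin 2}
    {C : Fin 2 → ℝ → Finset (V N)} (hq : NormSep (diffs (C i)) q)
    (hq' : JointSep (diffs (C i)) (diffs (C (other i))) q')
    (hd : d ≤ max (1 - q) 0) (hd' : d ≤ max (1 - q') 0 + max (α - q') 0) :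
    ExpLE (fun ρ => rxErrorProb α ρ (fun _ => {0}) (fun i => C i ρ) i) (-d) := by
  have hK : (0 : ℝ) ≤ 12 * N := by positivity
  -- The first bound makes `α - 1 + p'` nonpositive; the second gives `p' < 1 - q'`, selecting the
  -- double-fade branch.
  set p' : ℝ := min (1 - α) (-q') with hp'
  have h1 : p' ≤ 1 - α := min_le_left _ _
  have h2 : p' ≤ -q' := min_le_right _ _
  -- The value `p := 0` is arbitrary: a singleton codebook has no private differences.
  refine expLE_rxErrorProb hN (Cu := fun _ _ => {0}) (p := 0) (p' := p') (fun ρ _ u hu => ?_)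
    (fun δ _ => ?_) ?_ ?_ ?_ ?_ ?_ ?_
  · rw [Finset.mem_singleton.1 hu, norm_zero]
    positivity
  · filter_upwards [eventually_ge_atTop 0] with ρ hρ
    simp only [Finset.card_singleton, Nat.cast_one, Real.log_one]
    positivity
  · exact .of_empty fun δ ρ => by simp [normOutage, privateDiffs_zero]
  · refine (hq.outageLE _ _ hK).anti (hd.trans_eq ?_)
    rw [max_eq_right (a := α - 1 + p') (by linarith), sub_zero]
  · exact .of_empty fun δ ρ => by simp [normOutage, combinedDiffs_zero]
  · exact .of_empty fun δ ρ => by simp [jointOutage, privateDiffs_zero]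
  · refine (hq'.outageLE _ _ _ hK).anti (hd'.trans_eq ?_)
    rw [jointExponent, if_pos (by linarith)]
  · exact .of_empty fun δ ρ => by simp [jointOutage, combinedDiffs_zero]

lemma expLE_errorProb_public {N : ℕ} (hN : 1 ≤ N) {α d : ℝ} {Γ : Fin 3 → Fin 2 → ℝ}
    (hd : ∀ i, d ≤ dMUi α i (Γ i)) {C : Fin 2 → ℝ → Finset (V N)} (hM : MACCriteria Γ C) :
    ExpLE (fun ρ => errorProb α ρ (fun _ => {0}) (fun i => C i ρ)) (-d) := by
  refine ExpLE.errorProb (Cu := fun _ _ => {0}) fun i => ?_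
  have hJ := hM.joint.jointSep (q := Γ 2 0 + Γ 2 1) (by ring)
  have hd' : d ≤ max (1 - (Γ 2 0 + Γ 2 1)) 0 + max (α - (Γ 2 0 + Γ 2 1)) 0 := by
    simp only [← sub_sub]
    exact hd 2
  fin_cases i
  · exact expLE_rxErrorProb_public hN (hM.user1.normSep rfl) hJ (hd 0) hd'
  -- For the second receiver the own codebook is the second of the pair, hence `symm`.
  · exact expLE_rxErrorProb_public hN (hM.user2.normSep rfl) hJ.symm (hd 1) hd'

/-- Attainment makes the value a greatest element, so `sSup` needs no separate boundedness argument.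
-/
lemma dHK_eq_of_isOptimalSplit {α : ℝ} {r s t p : Fin 2 → ℝ} (h : IsOptimalSplit α r s t p) :
    dHK α r = dSplit α r s p :=
  IsGreatest.csSup_eq ⟨⟨s, t, p, h.1, rfl⟩, by
    rintro _ ⟨s', t', p', hf, rfl⟩
    exact h.2 s' t' p' hf⟩

end FadingIC

end

theorem theorem3 (N : ℕ) (hN : 2 ≤ N) (α : ℝ) (hα : 0 ≤ α)
    (r : Fin 2 → ℝ) (hr : ∀ i, 0 ≤ r i ∧ r i ≤ 1) :
    -- public messages only
    (FadingIC.dHK α r ≤ FadingIC.dMU α r →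
      ∀ (jstar : Fin 3), (∀ i, FadingIC.dMUi α jstar r ≤ FadingIC.dMUi α i r) →
      ∀ (Γ : Fin 3 → Fin 2 → ℝ), (∀ i, FadingIC.dMUi α i (Γ i) = FadingIC.dMUi α jstar r) →
      ∀ (C : Fin 2 → ℝ → Finset (FadingIC.V N)),
        (∀ i, FadingIC.IsCodebookSeq (r i) (C i)) →
        (∀ i, ∀ ρ : ℝ, 1 < ρ → ∀ x ∈ C i ρ, ‖x‖ ^ 2 ≤ N) →
        FadingIC.MACCriteria Γ C →
        FadingIC.ExpLE (fun ρ => FadingIC.errorProb α ρ (fun _ => {0}) (fun i => C i ρ))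
          (-FadingIC.dmt α r)) ∧
    -- superposition of private and public messages
    (FadingIC.dMU α r < FadingIC.dHK α r →
      ∀ (s t p : Fin 2 → ℝ), FadingIC.Feasible r s t p →
      ∀ (kstar : Fin 2) (lstar : Fin 6),
        (∀ n m, FadingIC.dkl α kstar lstar r s p ≤ FadingIC.dkl α n m r s p) →
      ∀ (Υ Ψ : Fin 2 → Fin 6 → Fin 2 → ℝ),
        (∀ n m, FadingIC.dkl α kstar lstar r s p ≤ FadingIC.dkl α n m (Υ n m) (Ψ n m) p) →
      ∀ (Cu Cw : Fin 2 → ℝ → Finset (FadingIC.V N)),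
        (∀ i, FadingIC.IsCodebookSeq (s i) (Cu i)) →
        (∀ i, FadingIC.IsCodebookSeq (t i) (Cw i)) →
        FadingIC.PowerSplit p Cu Cw →
        FadingIC.SuperpositionCriteria p Υ Ψ Cu Cw →
        FadingIC.ExpLE (fun ρ => FadingIC.errorProb α ρ (fun i => Cu i ρ) (fun i => Cw i ρ))
          (-FadingIC.dSplit α r s p) ∧
        (FadingIC.IsOptimalSplit α r s t p →
          FadingIC.ExpLE (fun ρ => FadingIC.errorProb α ρ (fun i => Cu i ρ) (fun i => Cw i ρ))
            (-FadingIC.dmt α r))) := by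
  have hN1 : 1 ≤ N := by omega
  refine ⟨fun hle jstar hj Γ hΓ C _ _ hM => ?_, fun hlt s t p _ kstar lstar _ Υ Ψ hd Cu Cw hCu _
    hP hS => ?_⟩
  · have hdmt : FadingIC.dmt α r = FadingIC.dMUi α jstar r := by
      rw [FadingIC.dmt, max_eq_right hle]
      exact le_antisymm (ciInf_le (Set.finite_range _).bddBelow jstar) (le_ciInf hj)
    rw [hdmt]
    exact FadingIC.expLE_errorProb_public hN1 (fun i => (hΓ i).ge) hM
  · have hle : FadingIC.dSplit α r s p ≤ FadingIC.dkl α kstar lstar r s p :=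
      ciInf_le (Set.finite_range fun kl : Fin 2 × Fin 6 =>
        FadingIC.dkl α kl.1 kl.2 r s p).bddBelow (kstar, lstar)
    have hmain := FadingIC.expLE_errorProb_superposition hN1
      (fun n m => hle.trans (hd n m)) hCu hP hS
    refine ⟨hmain, fun hopt => ?_⟩
    rwa [FadingIC.dmt, max_eq_left hlt.le, FadingIC.dHK_eq_of_isOptimalSplit hopt]
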